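/- Let $\mathbb D=\{z\in\mathbb C:|z|<1\}$ and $0\le\alpha<1$. Let $h$ and $g$ be analytic in $\mathbb D$ with $h(0)=g(0)=0$ and $h'(0)=1$, and suppose that $h'$ has no zero in $\mathbb D$, that $$\operatorname{Re}\Bigl(1+\frac{zh''(z)}{h'(z)}\Bigr)>\alpha\quad\text{for all } z\in\mathbb D,$$ and that for some $\theta\in\mathbb R$ one has $g'(z)=e^{i\theta}zh'(z)$ for all $z\in\mathbb D$. Put $f=h+\overline g$ and, for $\lambda\in\mathbb C$ with $|\lambda|=1$, $F_\lambda=h+\lambda g$. Then for every such $\lambda$, all $t,\psi\in\mathbb R$ with $e^{it}\ne e^{i\psi}$, and all $0<r<1$, $$\left|\frac{F_\lambda(re^{it})-F_\lambda(re^{i\psi})}{re^{it}-re^{i\psi}}\right|\ge\frac{1-r^2}{r^2}\,L(r,\alpha)^2 \qquad\text{and}\qquad \left|\frac{f(re^{it})-f(re^{i\psi})}{re^{it}-re^{i\psi}}\right|\ge\frac{1-r^2}{r^2}\,L(r,\alpha)^2,$$ where $$L(r,\alpha)=\begin{cases} \dfrac{2r}{1+r}-\log(1+r) & \text{if }\alpha=0,\\[2mm]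 2\log(1+r)-r & \text{if }\alpha=\tfrac12,\\[2mm] \dfrac{(1+r)^{2\alpha}(1+r+2\alpha-2r\alpha)-(1+r)(1+2\alpha)}{2\alpha(1+r)(2\alpha-1)} & \text{if }\alpha\in(0,1)\setminus\{\tfrac12\}. \end{cases}$$ -/

import Mathlib

open scoped ComplexConjugate

noncomputable section

/-- `f = h + conj g` on the open unit disk, with `h` and `g` analytic there and
`h 0 = g 0 = 0 = h' 0 - 1`: a normalized complex-valued harmonic function on the disk
with analytic part `h` and co-analytic part `g`. -/
structure NormalizedHarmonic (f h g : ℂ → ℂ) : Prop where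
  analytic_h : DifferentiableOn ℂ h (Metric.ball 0 1)
  analytic_g : DifferentiableOn ℂ g (Metric.ball 0 1)
  eq_add_conj : ∀ z ∈ Metric.ball (0 : ℂ) 1, f z = h z + conj (g z)
  h_zero : h 0 = 0
  g_zero : g 0 = 0
  deriv_h_zero : deriv h 0 = 1

/-- `f = h + conj g` belongs to the class `F(α)`: the analytic part `h` is convex of order `α`,
and `g' z = exp (i θ) * z * h' z` on the disk for one real number `θ`.
The quotient `z h'' / h'` presupposes that `h'` has no zero in the disk. -/
structure MemClassF (α : ℝ) (f h g : ℂ → ℂ) : Prop extends NormalizedHarmonic f h g where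
  deriv_ne_zero : ∀ z ∈ Metric.ball (0 : ℂ) 1, deriv h z ≠ 0
  convex_order : ∀ z ∈ Metric.ball (0 : ℂ) 1,
    α < (1 + z * deriv (deriv h) z / deriv h z).re
  dilatation : ∃ θ : ℝ, ∀ z ∈ Metric.ball (0 : ℂ) 1,
    deriv g z = Complex.exp (θ * Complex.I) * z * deriv h z

/-- The point `r * exp (i t)`. -/
def polarPoint (r t : ℝ) : ℂ := r * Complex.exp (t * Complex.I)

/-- The explicit function `L(r, α)`. -/
def distortionL (r α : ℝ) : ℝ :=
  if α = 0 then 2 * r / (1 + r) - Real.log (1 + r)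
  else if α = 1 / 2 then 2 * Real.log (1 + r) - r
  else ((1 + r) ^ (2 * α) * (1 + r + 2 * α - 2 * r * α) - (1 + r) * (1 + 2 * α)) /
    (2 * α * (1 + r) * (2 * α - 1))

/-- `A(r, α) = ((1 - r²) / r²) L(r, α)²`. -/
def distortionA (r α : ℝ) : ℝ := (1 - r ^ 2) / r ^ 2 * distortionL r α ^ 2

end

open Complex Metric Set Filter Topology

/-! Since `h` is convex, `h` is injective and maps each closed disk of radius `r < 1` onto a convex
set. Applying the mean value inequality to `G ∘ h⁻¹` on that set bounds `|ΔG|` by `sup |G'/h'| *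
|Δh|` (`norm_sub_le_mul_norm_sub_of_deriv`).

Two choices of `G` suffice. For `G = g` the dilatation gives `|Δg| ≤ r |Δh|`, so adding `λ Δg` or
`conj Δg` to `Δh` leaves at least `(1 - r) |Δh|`. For `G = id` the growth bound `|h'| ≥ (1 + r) ^
(2α - 2)` (`re_log_deriv_ge`) gives `|Δh| ≥ (1 + r) ^ (2α - 2) |Δz|`. Hence both quotients are at
least `(1 - r) (1 + r) ^ (2α - 2)`.

This is the derivative of `L`, and calculus shows that it dominates `A(r, α)` (`distortionA_le`). -/

theorem exists_exp_eq_deriv {h : ℂ → ℂ} (hd : DifferentiableOn ℂ h (ball 0 1))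
    (hne : ∀ z ∈ ball (0 : ℂ) 1, deriv h z ≠ 0) (h1 : deriv h 0 = 1) :
    ∃ q : ℂ → ℂ, q 0 = 0 ∧ ∀ z ∈ ball (0 : ℂ) 1,
      HasDerivAt q (deriv (deriv h) z / deriv h z) z ∧ deriv h z = exp (q z) := by
  have hd' : DifferentiableOn ℂ (deriv h) (ball 0 1) := hd.deriv isOpen_ball
  have hd'' : DifferentiableOn ℂ (deriv (deriv h)) (ball 0 1) := hd'.deriv isOpen_ball
  obtain ⟨q, hq0, hq⟩ := (hd''.div hd' hne).isExactOn_ball.with_val_at 0 0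
  refine ⟨q, hq0, fun z hz => ⟨hq z hz, ?_⟩⟩
  -- `h' * exp (-q)` has zero derivative, hence keeps its value `1` at the origin.
  have key : ∀ w ∈ ball (0 : ℂ) 1,
      HasDerivWithinAt (fun w => deriv h w * exp (-q w)) 0 (ball 0 1) w := by
    intro w hw
    have a := ((hd'.differentiableAt (isOpen_ball.mem_nhds hw)).hasDerivAt.mul
      (hq w hw).neg.cexp).hasDerivWithinAt (s := ball 0 1)
    refine a.congr_deriv ?_
    have := hne w hw
    simp only [Pi.div_apply]
    field_simp
    ring
  have hc := (convex_ball (0 : ℂ) 1).norm_image_sub_le_of_norm_hasDerivWithin_le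
    (C := 0) key (by simp) (mem_ball_self one_pos) hz
  simp only [zero_mul, norm_le_zero_iff, sub_eq_zero, h1, hq0, neg_zero, exp_zero, mul_one] at hc
  rw [exp_neg, mul_inv_eq_one₀ (exp_ne_zero _)] at hc
  exact hc

theorem norm_ofReal_mul_exp {r : ℝ} (hr : 0 ≤ r) (t : ℝ) :
    ‖(r : ℂ) * exp (t * I)‖ = r := by
  rw [norm_mul, norm_exp_ofReal_mul_I, mul_one, norm_real, Real.norm_of_nonneg hr]

theorem hasDerivAt_ofReal_mul_exp (r t : ℝ) :
    HasDerivAt (fun t : ℝ => (r : ℂ) * exp (t * I)) (r * exp (t * I) * I) t := by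
  have := (((hasDerivAt_id t).ofReal_comp.mul_const I).cexp).const_mul (r : ℂ)
  refine this.congr_deriv ?_
  simp; ring

theorem IsPreconnected.inter_frontier_nonempty {X : Type*} [TopologicalSpace X] {s t : Set X}
    (hs : IsPreconnected s) (h1 : (s ∩ t).Nonempty) (h2 : (s ∩ tᶜ).Nonempty) :
    (s ∩ frontier t).Nonempty := by
  by_contra hne
  have hnf : ∀ x ∈ s, x ∉ frontier t := fun x hx hxf => hne ⟨x, hx, hxf⟩
  have hint : ∀ x ∈ s, x ∈ t → x ∈ interior t := fun x hx hxt => by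
    by_contra hxi
    exact hnf x hx ⟨subset_closure hxt, hxi⟩
  have hext : ∀ x ∈ s, x ∉ t → x ∈ (closure t)ᶜ := fun x hx hxt hxc =>
    hnf x hx ⟨hxc, fun hxi => hxt (interior_subset hxi)⟩
  obtain ⟨x, -, hx1, hx2⟩ := hs (interior t) (closure t)ᶜ isOpen_interior
    isClosed_closure.isOpen_compl
    (fun x hx => (em (x ∈ t)).imp (hint x hx) (hext x hx))
    (h1.imp fun x hx => ⟨hx.1, hint x hx.1 hx.2⟩) (h2.imp fun x hx => ⟨hx.1, hext x hx.1 hx.2⟩)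
  exact hx2 (interior_subset_closure hx1)

/-! ### Supporting lines and convexity of the images of disks -/

section Support

variable {h q q' : ℂ → ℂ} (hh : ∀ z ∈ ball (0 : ℂ) 1, HasDerivAt h (exp (q z)) z)
  (hq : ∀ z ∈ ball (0 : ℂ) 1, HasDerivAt q (q' z) z)
  (hconv : ∀ z ∈ ball (0 : ℂ) 1, 0 < (1 + z * q' z).re)
include hh hq hconv

/-- Along the circle the tangent angle, measured from its value at `t₀`, is `Im E`; it increases
strictly from `0` to `2π`. The height `u` above the tangent line has derivative `exp (Re E) * sin
(Im E)`, so it rises from `0` until the angle is `π`, then falls back to `0`. -/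
theorem re_support_pos_of_mem_Ioo {r : ℝ} (hr0 : 0 < r) (hr1 : r < 1) {t₀ t : ℝ}
    (ht : t ∈ Ioo t₀ (t₀ + 2 * Real.pi)) :
    0 < ((h (r * exp (t₀ * I)) - h (r * exp (t * I))) /
      (r * exp (t₀ * I) * exp (q (r * exp (t₀ * I))))).re := by
  set c : ℝ → ℂ := fun t => (r : ℂ) * exp (t * I) with hc
  have hcb : ∀ t, c t ∈ ball (0 : ℂ) 1 := fun t => by
    rw [mem_ball_zero_iff, hc, norm_ofReal_mul_exp hr0.le]; exact hr1
  have hcd : ∀ t, HasDerivAt c (c t * I) t := hasDerivAt_ofReal_mul_exp r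
  have hper : c (t₀ + 2 * Real.pi) = c t₀ := by
    simp only [hc]; push_cast; rw [add_mul, exp_periodic]
  have hc0 : ∀ t, c t ≠ 0 := fun t =>
    mul_ne_zero (ofReal_ne_zero.2 hr0.ne') (exp_ne_zero _)
  have hdiv : ∀ s, c s / c t₀ = exp (((s - t₀ : ℝ) : ℂ) * I) := fun s => by
    rw [div_eq_iff (hc0 _)]
    simp only [hc]
    rw [mul_left_comm, ← exp_add]; push_cast; ring_nf
  set u : ℝ → ℝ := fun s => ((h (c t₀) - h (c s)) / (c t₀ * exp (q (c t₀)))).re with hu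
  set E : ℝ → ℂ := fun s => ((s - t₀ : ℝ) : ℂ) * I + q (c s) - q (c t₀) with hE
  have hEd : ∀ s, HasDerivAt E (I + q' (c s) * (c s * I)) s := fun s => by
    have a := ((((hasDerivAt_id s).sub_const t₀).ofReal_comp.mul_const I).add
      ((hq _ (hcb s)).comp s (hcd s))).sub_const (q (c t₀))
    refine a.congr_deriv ?_
    simp
  have hPd : ∀ s, HasDerivAt (fun s => (E s).im) ((1 + c s * q' (c s)).re) s := fun s => by
    have := imCLM.hasFDerivAt.comp_hasDerivAt s (hEd s)
    refine this.congr_deriv ?_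
    simp
    ring
  have hmono : StrictMono fun s => (E s).im := strictMono_of_deriv_pos fun s => by
    rw [(hPd s).deriv]; exact hconv _ (hcb s)
  have hud : ∀ s, HasDerivAt u (Real.exp (E s).re * Real.sin (E s).im) s := fun s => by
    have a := (((hh _ (hcb s)).comp s (hcd s)).const_sub (h (c t₀))).div_const
      (c t₀ * exp (q (c t₀)))
    have b := reCLM.hasFDerivAt.comp_hasDerivAt s a
    refine b.congr_deriv ?_
    have : -(exp (q (c s)) * (c s * I)) / (c t₀ * exp (q (c t₀))) = -(exp (E s) * I) := by
      simp only [hE]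
      rw [exp_sub, exp_add, ← hdiv]
      have := hc0 t₀
      field_simp
    simp only [reCLM_apply, this]
    simp [exp_im]
  have hucont : Continuous u := continuous_iff_continuousAt.2 fun s => (hud s).continuousAt
  have hE0 : (E t₀).im = 0 := by simp [hE]
  have hE1 : (E (t₀ + 2 * Real.pi)).im = 2 * Real.pi := by simp [hE, hper]
  have hu0 : u t₀ = 0 := by simp [hu]
  have hu1 : u (t₀ + 2 * Real.pi) = 0 := by simp [hu, hper]
  have hpi := Real.pi_pos
  obtain ⟨m, hm, hEm⟩ : ∃ m ∈ Icc t₀ (t₀ + 2 * Real.pi), (E m).im = Real.pi := by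
    refine intermediate_value_Icc (f := fun s => (E s).im) (by linarith)
      (continuous_iff_continuousAt.2 fun s => (hPd s).continuousAt).continuousOn ⟨?_, ?_⟩
    · simp only [hE0]; exact hpi.le
    · simp only [hE1]; linarith
  change 0 < u t
  rcases le_total t m with htm | htm
  · have : StrictMonoOn u (Icc t₀ m) := strictMonoOn_of_deriv_pos (convex_Icc _ _)
      hucont.continuousOn fun s hs => by
        rw [interior_Icc] at hs
        rw [(hud s).deriv]
        refine mul_pos (Real.exp_pos _) (Real.sin_pos_of_pos_of_lt_pi ?_ ?_)
        · rw [← hE0]; exact hmono hs.1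
        · rw [← hEm]; exact hmono hs.2
    rw [← hu0]
    exact this ⟨le_rfl, hm.1⟩ ⟨ht.1.le, htm⟩ ht.1
  · have : StrictAntiOn u (Icc m (t₀ + 2 * Real.pi)) := strictAntiOn_of_deriv_neg (convex_Icc _ _)
      hucont.continuousOn fun s hs => by
        rw [interior_Icc] at hs
        rw [(hud s).deriv]
        have h1 : Real.pi < (E s).im := by rw [← hEm]; exact hmono hs.1
        have h2 : (E s).im < 2 * Real.pi := by rw [← hE1]; exact hmono hs.2
        have h3 : Real.sin (E s).im < 0 := by
          rw [← Real.sin_sub_two_pi]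
          exact Real.sin_neg_of_neg_of_neg_pi_lt (by linarith) (by linarith)
        exact mul_neg_of_pos_of_neg (Real.exp_pos _) h3
    rw [← hu1]
    exact this ⟨htm, ht.2.le⟩ ⟨hm.2, le_rfl⟩ ht.2

theorem re_support_pos_of_norm_eq {z w : ℂ} (hw : ‖w‖ < 1) (hzw : ‖z‖ = ‖w‖) (hne : z ≠ w) :
    0 < ((h w - h z) / (w * exp (q w))).re := by
  have hw0 : 0 < ‖w‖ := by
    rw [norm_pos_iff]; rintro rfl
    exact hne (norm_eq_zero.1 (by simpa using hzw))
  -- The argument of `z` is moved into the period starting at `arg w`.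
  have h1 := toIcoMod_mem_Ico Real.two_pi_pos (arg w) (arg z)
  set s := toIcoMod Real.two_pi_pos (arg w) (arg z) with hs
  have hsz : (‖w‖ : ℂ) * exp (s * I) = z := by
    have : s = arg z - toIcoDiv Real.two_pi_pos (arg w) (arg z) • (2 * Real.pi) := rfl
    rw [this, ← hzw]
    conv_rhs => rw [← norm_mul_exp_arg_mul_I z]
    congr 1
    rw [exp_eq_exp_iff_exists_int]
    refine ⟨-toIcoDiv Real.two_pi_pos (arg w) (arg z), ?_⟩
    push_cast [zsmul_eq_mul]
    ring
  have h2 : s ≠ arg w := fun e => hne <| by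
    rw [← hsz, e, norm_mul_exp_arg_mul_I]
  have := re_support_pos_of_mem_Ioo hh hq hconv hw0 hw ⟨lt_of_le_of_ne h1.1 h2.symm, h1.2⟩
  rwa [hsz, norm_mul_exp_arg_mul_I] at this

/-- Maximum modulus principle for `exp` of minus the quotient: its modulus is at most `1` on the
circle through `w`. -/
theorem re_support_nonneg {z w : ℂ} (hw : ‖w‖ < 1) (hzw : ‖z‖ ≤ ‖w‖) :
    0 ≤ ((h w - h z) / (w * exp (q w))).re := by
  rcases eq_or_ne w 0 with rfl | hw0
  · simp
  have hwp : ‖w‖ ≠ 0 := norm_ne_zero_iff.2 hw0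
  have hsub : closedBall (0 : ℂ) ‖w‖ ⊆ ball 0 1 := closedBall_subset_ball hw
  have hd : DiffContOnCl ℂ (fun z => exp (-((h w - h z) / (w * exp (q w))))) (ball 0 ‖w‖) := by
    apply DifferentiableOn.diffContOnCl
    rw [closure_ball _ hwp]
    intro y hy
    exact (((hh y (hsub hy)).const_sub (h w)).div_const _).neg.cexp
      |>.differentiableAt.differentiableWithinAt
  have := norm_le_of_forall_mem_frontier_norm_le (C := 1) isBounded_ball hd (z := z) ?_ ?_
  · rw [norm_exp, Real.exp_le_one_iff, neg_re] at this
    linarith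
  · intro y hy
    rw [frontier_ball _ hwp, mem_sphere_zero_iff_norm] at hy
    rw [norm_exp, Real.exp_le_one_iff, neg_re, neg_nonpos]
    rcases eq_or_ne y w with rfl | hne
    · simp
    · exact (re_support_pos_of_norm_eq hh hq hconv hw hy hne).le
  · rwa [closure_ball _ hwp, mem_closedBall_zero_iff]

omit hq hconv in
theorem map_nhds_eq_of_exp_deriv {z : ℂ} (hz : z ∈ ball (0 : ℂ) 1) : map h (𝓝 z) = 𝓝 (h z) := by
  have hd : DifferentiableOn ℂ h (ball 0 1) := fun y hy =>
    (hh y hy).differentiableAt.differentiableWithinAt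
  have : HasStrictDerivAt h (exp (q z)) z := by
    have := (hd.analyticAt (isOpen_ball.mem_nhds hz)).hasStrictDerivAt
    rwa [(hh z hz).deriv] at this
  exact this.map_nhds_eq (exp_ne_zero _)

/-- In the interior, strictness comes from openness of `h`: points slightly beyond `h z` in the
outward direction `d` are still values of `h` and satisfy the weak inequality. -/
theorem re_support_pos {z w : ℂ} (hw : ‖w‖ < 1) (hzw : ‖z‖ ≤ ‖w‖) (hne : z ≠ w) :
    0 < ((h w - h z) / (w * exp (q w))).re := by
  rcases hzw.eq_or_lt with he | hlt
  · exact re_support_pos_of_norm_eq hh hq hconv hw he hne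
  set d := w * exp (q w) with hd
  have hd0 : d ≠ 0 := mul_ne_zero
    (norm_pos_iff.1 ((norm_nonneg z).trans_lt hlt)) (exp_ne_zero _)
  have h1 : ∀ᶠ y in 𝓝 (h z), 0 ≤ ((h w - y) / d).re := by
    rw [← map_nhds_eq_of_exp_deriv hh (mem_ball_zero_iff.2 (hlt.trans hw)), eventually_map]
    filter_upwards [isOpen_ball.mem_nhds (mem_ball_zero_iff.2 hlt)] with y hy
    exact re_support_nonneg hh hq hconv hw (mem_ball_zero_iff.1 hy).le
  have h2 : Tendsto (fun ε : ℝ => h z + ε * d) (𝓝[>] 0) (𝓝 (h z)) := by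
    have : Continuous fun ε : ℝ => h z + ε * d := by fun_prop
    simpa using (this.tendsto 0).mono_left nhdsWithin_le_nhds
  obtain ⟨ε, h3, hε⟩ := ((h2.eventually h1).and self_mem_nhdsWithin).exists
  have h4 : (h w - (h z + ε * d)) / d = (h w - h z) / d - ε := by field_simp; ring
  rw [h4, sub_re, ofReal_re] at h3
  exact (mem_Ioi.1 hε).trans_le (by linarith)

theorem injOn_of_convex_re : InjOn h (ball 0 1) := by
  intro z hz w hw he
  by_contra hne
  rw [mem_ball_zero_iff] at hz hw
  rcases le_total ‖z‖ ‖w‖ with hl | hl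
  · simpa [he] using re_support_pos hh hq hconv hw hl hne
  · simpa [he] using re_support_pos hh hq hconv hz hl (Ne.symm hne)

/-- The image is the intersection of its supporting half-planes. If `p` lay in all of them but
outside the image, the segment from `h 0` to `p` would meet the boundary at some `h w`; but `h 0` is
strictly inside the half-plane at `w`, which excludes this. -/
theorem convex_image_closedBall {r : ℝ} (hr0 : 0 < r) (hr1 : r < 1) :
    Convex ℝ (h '' closedBall 0 r) := by
  have hsub : closedBall (0 : ℂ) r ⊆ ball 0 1 := closedBall_subset_ball hr1
  have hK : IsCompact (h '' closedBall 0 r) := (isCompact_closedBall 0 r).image_of_continuousOn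
    fun y hy => (hh y (hsub hy)).continuousAt.continuousWithinAt
  have hfr : frontier (h '' closedBall 0 r) ⊆ h '' sphere 0 r := by
    rw [hK.isClosed.frontier_eq]
    rintro _ ⟨⟨y, hy, rfl⟩, hni⟩
    refine ⟨y, ?_, rfl⟩
    by_contra hs
    have hlt : y ∈ ball (0 : ℂ) r := mem_ball.2 (lt_of_le_of_ne hy hs)
    apply hni
    rw [mem_interior_iff_mem_nhds, ← map_nhds_eq_of_exp_deriv hh (hsub hy)]
    exact image_mem_map (mem_of_superset (isOpen_ball.mem_nhds hlt) ball_subset_closedBall)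
  have hEq : h '' closedBall 0 r =
      ⋂ w ∈ sphere (0 : ℂ) r, {y | 0 ≤ ((h w - y) / (w * exp (q w))).re} := by
    apply Subset.antisymm
    · rintro _ ⟨y, hy, rfl⟩
      simp only [mem_iInter, mem_sphere_zero_iff_norm]
      intro w hw
      exact re_support_nonneg hh hq hconv (hw ▸ hr1) (hw ▸ mem_closedBall_zero_iff.1 hy)
    · intro p hp
      by_contra hpK
      have hseg : (segment ℝ (h 0) p ∩ frontier (h '' closedBall 0 r)).Nonempty :=
        IsPreconnected.inter_frontier_nonempty (convex_segment (h 0) p).isPreconnected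
          ⟨h 0, left_mem_segment _ _ _, 0, mem_closedBall_self hr0.le, rfl⟩
          ⟨p, right_mem_segment _ _ _, hpK⟩
      obtain ⟨y, ⟨a, b, ha, hb, hab, rfl⟩, hy⟩ := hseg
      obtain ⟨w, hw, hwe⟩ := hfr hy
      have ha' : a ≠ 0 := by
        rintro rfl
        apply hpK
        have hb1 : b = 1 := by linarith
        have := hK.isClosed.frontier_subset hy
        simpa [hb1] using this
      have hwn : ‖w‖ = r := mem_sphere_zero_iff_norm.1 hw
      have h0 : 0 < ((h w - h 0) / (w * exp (q w))).re :=
        re_support_pos hh hq hconv (hwn ▸ hr1) (by simp) (by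
          rintro rfl; simp at hwn; exact hr0.ne hwn)
      have hp' : 0 ≤ ((h w - p) / (w * exp (q w))).re := mem_iInter₂.1 hp w hw
      have hsum : (a : ℂ) * ((h w - h 0) / (w * exp (q w))) + b * ((h w - p) / (w * exp (q w)))
          = 0 := by
        have hab' : (a : ℂ) + b = 1 := by exact_mod_cast hab
        have : (a : ℂ) * (h w - h 0) + b * (h w - p) = 0 := by
          simp only [real_smul] at hwe
          linear_combination hwe + h w * hab'
        rw [← mul_div_assoc, ← mul_div_assoc, ← add_div, this, zero_div]
      have hre := congrArg re hsum
      rw [add_re, re_ofReal_mul, re_ofReal_mul, zero_re] at hre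
      have : 0 < a * ((h w - h 0) / (w * exp (q w))).re :=
        mul_pos (lt_of_le_of_ne ha ha'.symm) h0
      nlinarith [mul_nonneg hb hp']
  rw [hEq]
  refine convex_iInter₂ fun w _ => ?_
  intro x hx y hy a b ha hb hab
  have hab' : (a : ℂ) + b = 1 := by exact_mod_cast hab
  have : (h w - (a • x + b • y)) / (w * exp (q w)) =
      (a : ℂ) * ((h w - x) / (w * exp (q w))) + b * ((h w - y) / (w * exp (q w))) := by
    rw [← mul_div_assoc, ← mul_div_assoc, ← add_div]
    congr 1
    simp only [real_smul]
    linear_combination -h w * hab'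
  simp only [mem_ofPred_eq, this, add_re, re_ofReal_mul] at hx hy ⊢
  exact add_nonneg (mul_nonneg ha hx) (mul_nonneg hb hy)

/-- If `‖G' / h'‖ ≤ C` on a closed disk, then increments of `G` are at most `C` times those
of `h`. -/
theorem norm_sub_le_mul_norm_sub_of_deriv {G G' : ℂ → ℂ} {r C : ℝ} (hr0 : 0 < r) (hr1 : r < 1)
    (hG : ∀ z ∈ closedBall (0 : ℂ) r, HasDerivAt G (G' z) z)
    (hC : ∀ z ∈ closedBall (0 : ℂ) r, ‖G' z * (exp (q z))⁻¹‖ ≤ C) {a b : ℂ}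
    (ha : a ∈ closedBall (0 : ℂ) r) (hb : b ∈ closedBall (0 : ℂ) r) :
    ‖G b - G a‖ ≤ C * ‖h b - h a‖ := by
  have hsub : closedBall (0 : ℂ) r ⊆ ball 0 1 := closedBall_subset_ball hr1
  have hinj := injOn_of_convex_re hh hq hconv
  set k := Function.invFunOn h (ball 0 1) with hk
  have hl : ∀ z ∈ ball (0 : ℂ) 1, k (h z) = z := fun z hz => hinj.leftInvOn_invFunOn hz
  have hd : DifferentiableOn ℂ h (ball 0 1) := fun y hy =>
    (hh y hy).differentiableAt.differentiableWithinAt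
  have hkd : ∀ z ∈ ball (0 : ℂ) 1, HasDerivAt k (exp (q z))⁻¹ (h z) := fun z hz => by
    have := (hd.analyticAt (isOpen_ball.mem_nhds hz)).hasStrictDerivAt
    rw [(hh z hz).deriv] at this
    refine (this.to_local_left_inverse (exp_ne_zero _) ?_).hasDerivAt
    filter_upwards [isOpen_ball.mem_nhds hz] with y hy using hl y hy
  have := (convex_image_closedBall hh hq hconv hr0 hr1).norm_image_sub_le_of_norm_hasDerivWithin_le
    (f := fun y => G (k y)) (f' := fun y => G' (k y) * (exp (q (k y)))⁻¹) (C := C)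
    (x := h a) (y := h b) ?_ ?_ ⟨a, ha, rfl⟩ ⟨b, hb, rfl⟩
  · simpa only [hl _ (hsub ha), hl _ (hsub hb)] using this
  · rintro _ ⟨z, hz, rfl⟩
    have e := hl z (hsub hz)
    have h1 : HasDerivAt G (G' (k (h z))) (k (h z)) := by rw [e]; exact hG z hz
    have h2 := h1.comp (h z) (hkd z (hsub hz))
    rw [e] at h2 ⊢
    exact h2.hasDerivWithinAt
  · rintro _ ⟨z, hz, rfl⟩
    simp only [hl z (hsub hz)]
    exact hC z hz

end Support

/-! ### Growth of `h'` -/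

/-- Schwarz lemma for the Cayley transform `(P - 1) / (P + 1)`. -/
theorem re_ge_of_re_pos {P : ℂ → ℂ} (hd : DifferentiableOn ℂ P (ball 0 1))
    (hpos : ∀ z ∈ ball (0 : ℂ) 1, 0 < (P z).re) (h0 : P 0 = 1) {z : ℂ} (hz : ‖z‖ < 1) :
    (1 - ‖z‖) / (1 + ‖z‖) ≤ (P z).re := by
  have hne : ∀ w ∈ ball (0 : ℂ) 1, P w + 1 ≠ 0 := fun w hw e => by
    have := congrArg re e
    simp at this
    linarith [hpos w hw]
  have hb : MapsTo (fun w => (P w - 1) / (P w + 1)) (ball 0 1) (closedBall 0 1) := by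
    intro w hw
    rw [mem_closedBall_zero_iff, norm_div, div_le_one (norm_pos_iff.2 (hne w hw)),
      ← abs_of_nonneg (norm_nonneg (P w - 1)), ← abs_of_nonneg (norm_nonneg (P w + 1)),
      ← sq_le_sq, ← normSq_eq_norm_sq, ← normSq_eq_norm_sq]
    simp only [normSq_apply, sub_re, add_re, one_re, sub_im, add_im, one_im]
    nlinarith [hpos w hw]
  have hs := norm_le_norm_of_mapsTo_ball (f := fun w => (P w - 1) / (P w + 1))
    ((hd.sub_const 1).div (hd.add_const 1) hne) hb (by simp [h0]) hz
  have hz0 := norm_nonneg z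
  rw [norm_div, div_le_iff₀ (norm_pos_iff.2 (hne z (mem_ball_zero_iff.2 hz)))] at hs
  have h2 := pow_le_pow_left₀ (norm_nonneg _) hs 2
  rw [mul_pow, ← normSq_eq_norm_sq (P z - 1), ← normSq_eq_norm_sq (P z + 1)] at h2
  simp only [normSq_apply, sub_re, add_re, one_re, sub_im, add_im, one_im] at h2
  have hp := hpos z (mem_ball_zero_iff.2 hz)
  set x := (P z).re
  set y := (P z).im
  set ρ := ‖z‖
  rw [div_le_iff₀ (by linarith)]
  by_contra! hlt
  have hy : 0 ≤ y * y * (1 - ρ ^ 2) := mul_nonneg (mul_self_nonneg y) (by nlinarith)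
  have h3 : (x - 1) * (x - 1) ≤ ρ ^ 2 * ((x + 1) * (x + 1)) := by nlinarith
  have h4 : ρ * (x + 1) < 1 - x := by linarith
  have h5 : 0 ≤ ρ * (x + 1) := by positivity
  nlinarith

/-- The previous bound, applied to `(1 + z q' - α) / (1 - α)`, controls the radial derivative of `Re
q`; the claim is its integral along the radius. -/
theorem re_log_deriv_ge {q q' : ℂ → ℂ} {α : ℝ} (hα1 : α < 1) (hq0 : q 0 = 0)
    (hq : ∀ z ∈ ball (0 : ℂ) 1, HasDerivAt q (q' z) z)
    (hconv : ∀ z ∈ ball (0 : ℂ) 1, α < (1 + z * q' z).re) {z : ℂ} (hz : ‖z‖ < 1) :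
    (2 * α - 2) * Real.log (1 + ‖z‖) ≤ (q z).re := by
  have hα : 0 < 1 - α := by linarith
  have hqd : DifferentiableOn ℂ q (ball 0 1) := fun y hy =>
    (hq y hy).differentiableAt.differentiableWithinAt
  have hq'd : DifferentiableOn ℂ q' (ball 0 1) :=
    (hqd.deriv isOpen_ball).congr fun y hy => (hq y hy).deriv.symm
  have key : ∀ w : ℂ, ‖w‖ < 1 → (2 * α - 2) * ‖w‖ / (1 + ‖w‖) ≤ (w * q' w).re := by
    intro w hw
    have := re_ge_of_re_pos (P := fun w => (1 + w * q' w - α) * ((1 - α : ℝ) : ℂ)⁻¹)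
      (by fun_prop) (fun y hy => ?_) ?_ hw
    · rw [← ofReal_inv, re_mul_ofReal, ← div_eq_mul_inv, le_div_iff₀ hα, sub_re, ofReal_re,
        add_re, one_re] at this
      have h2 : (1 - ‖w‖) / (1 + ‖w‖) * (1 - α) =
          (1 - α) + (2 * α - 2) * ‖w‖ / (1 + ‖w‖) := by
        have : 1 + ‖w‖ ≠ 0 := by positivity
        field_simp
        ring
      linarith
    · rw [← ofReal_inv, re_mul_ofReal]
      refine mul_pos ?_ (inv_pos.2 hα)
      rw [sub_re, ofReal_re]
      linarith [hconv y hy]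
    · have : (1 : ℂ) - α ≠ 0 := by exact_mod_cast hα.ne'
      simp [this]
  set φ : ℝ → ℝ := fun s => (q (s * z)).re - (2 * α - 2) * Real.log (1 + s * ‖z‖) with hφ
  have hmem : ∀ s ∈ Icc (0 : ℝ) 1, ‖(s : ℂ) * z‖ = s * ‖z‖ ∧ s * ‖z‖ < 1 := fun s hs => by
    refine ⟨by rw [norm_mul, norm_real, Real.norm_of_nonneg hs.1], ?_⟩
    exact (mul_le_of_le_one_left (norm_nonneg z) hs.2).trans_lt hz
  have hφd : ∀ s ∈ Icc (0 : ℝ) 1, HasDerivAt φ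
      ((q' (s * z) * z).re - (2 * α - 2) * (‖z‖ / (1 + s * ‖z‖))) s := fun s hs => by
    obtain ⟨h1, h2⟩ := hmem s hs
    have hs0 := hs.1
    have a : HasDerivAt (fun s : ℝ => (s : ℂ) * z) z s := by
      simpa using (hasDerivAt_id s).ofReal_comp.mul_const z
    have b := reCLM.hasFDerivAt.comp_hasDerivAt s
      ((hq (s * z) (by rw [mem_ball_zero_iff, h1]; exact h2)).comp s a)
    have c : HasDerivAt (fun s : ℝ => 1 + s * ‖z‖) ‖z‖ s := by
      simpa using ((hasDerivAt_id s).mul_const ‖z‖).const_add 1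
    exact b.sub ((c.log (by positivity)).const_mul _)
  have hm : MonotoneOn φ (Icc 0 1) := by
    refine monotoneOn_of_deriv_nonneg (convex_Icc _ _)
      (fun s hs => (hφd s hs).continuousAt.continuousWithinAt)
      (fun s hs => (hφd s (interior_subset hs)).differentiableAt.differentiableWithinAt) ?_
    intro s hs
    rw [(hφd s (interior_subset hs)).deriv]
    rw [interior_Icc] at hs
    obtain ⟨h1, h2⟩ := hmem s ⟨hs.1.le, hs.2.le⟩
    have h3 := key (s * z) (by rw [h1]; exact h2)
    have h4 : (s : ℂ) * z * q' (s * z) = s * (q' (s * z) * z) := by ring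
    rw [h1, h4, re_ofReal_mul] at h3
    have h5 : (2 * α - 2) * (s * ‖z‖) / (1 + s * ‖z‖) =
      s * ((2 * α - 2) * (‖z‖ / (1 + s * ‖z‖))) := by ring
    rw [h5] at h3
    exact sub_nonneg.2 (le_of_mul_le_mul_left h3 hs.1)
  have := hm (left_mem_Icc.2 zero_le_one) (right_mem_Icc.2 zero_le_one) zero_le_one
  simp only [hφ, ofReal_zero, zero_mul, hq0, zero_re, add_zero, Real.log_one, mul_zero, sub_zero,
    ofReal_one, one_mul] at this
  linarith

/-! ### Calculus of `L` and `A` -/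

theorem distortionL_zero (α : ℝ) : distortionL 0 α = 0 := by
  unfold distortionL
  split_ifs <;> simp

/-- One derivative covers all three cases of `L`: the special ones are where integrating the power
of `1 + r` produces a logarithm. -/
theorem hasDerivAt_distortionL (α : ℝ) {r : ℝ} (hr : -1 < r) :
    HasDerivAt (fun r => distortionL r α) ((1 - r) * (1 + r) ^ (2 * α - 2)) r := by
  have h1 : 0 < 1 + r := by linarith
  have hid : HasDerivAt (fun r : ℝ => 1 + r) 1 r := (hasDerivAt_id r).const_add 1
  have hlog : HasDerivAt (fun r : ℝ => Real.log (1 + r)) (1 / (1 + r)) r := hid.log h1.ne'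
  unfold distortionL
  split_ifs with h0 h2
  · have := ((((hasDerivAt_id r).const_mul 2).div hid h1.ne')).sub hlog
    refine this.congr_deriv ?_
    have e : (1 + r) ^ (2 * α - 2) = ((1 + r) ^ 2)⁻¹ := by
      rw [h0, ← Real.rpow_natCast, ← Real.rpow_neg h1.le]; norm_num
    rw [e]
    simp only [id]
    field_simp
    ring
  · have := (hlog.const_mul 2).sub (hasDerivAt_id r)
    refine this.congr_deriv ?_
    have e : (1 + r) ^ (2 * α - 2) = (1 + r)⁻¹ := by
      rw [h2, ← Real.rpow_neg_one]; norm_num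
    rw [e]
    field_simp
    ring
  · have hp : HasDerivAt (fun r : ℝ => (1 + r) ^ (2 * α)) (1 * (2 * α) * (1 + r) ^ (2 * α - 1)) r :=
      hid.rpow_const (Or.inl h1.ne')
    have hlin : HasDerivAt (fun r : ℝ => 1 + r + 2 * α - 2 * r * α) (1 - 2 * 1 * α) r :=
      (hid.add_const _).sub (((hasDerivAt_id r).const_mul 2).mul_const α)
    have h3 : 2 * α - 1 ≠ 0 := fun e => h2 (by linarith)
    have hden : 2 * α * (1 + r) * (2 * α - 1) ≠ 0 := by positivity
    have := ((hp.mul hlin).sub (hid.mul_const (1 + 2 * α))).div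
      ((hid.const_mul (2 * α)).mul_const (2 * α - 1)) hden
    refine this.congr_deriv ?_
    have e1 : (1 + r) ^ (2 * α) = (1 + r) ^ (2 * α - 2) * (1 + r) ^ 2 := by
      rw [← Real.rpow_natCast, ← Real.rpow_add h1]; norm_num
    have e2 : (1 + r) ^ (2 * α - 1) = (1 + r) ^ (2 * α - 2) * (1 + r) := by
      rw [← Real.rpow_add_one h1.ne']; ring_nf
    simp only [Pi.mul_apply, Pi.sub_apply, e1, e2]
    generalize (1 + r) ^ (2 * α - 2) = X
    field_simp
    ring

theorem distortionL_nonneg {α r : ℝ} (hr0 : 0 ≤ r) (hr1 : r ≤ 1) : 0 ≤ distortionL r α := by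
  have hd : ∀ s ∈ Icc (0 : ℝ) 1, HasDerivAt (fun r => distortionL r α) _ s := fun s hs =>
    hasDerivAt_distortionL α (by linarith [hs.1])
  have hm : MonotoneOn (fun r => distortionL r α) (Icc 0 1) := by
    refine monotoneOn_of_deriv_nonneg (convex_Icc _ _)
      (fun s hs => (hd s hs).continuousAt.continuousWithinAt)
      (fun s hs => (hd s (interior_subset hs)).differentiableAt.differentiableWithinAt) ?_
    intro s hs
    rw [(hd s (interior_subset hs)).deriv]
    rw [interior_Icc] at hs
    exact mul_nonneg (by linarith [hs.2]) (Real.rpow_nonneg (by linarith [hs.1]) _)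
  simpa [distortionL_zero] using hm (left_mem_Icc.2 zero_le_one) ⟨hr0, hr1⟩ hr0

/-- Bernoulli's inequality for exponents in `[0, 1]`; when `α ≥ 1/2` one factor `1 + r` is split off
first. -/
theorem one_sub_mul_rpow_le {α r : ℝ} (hα0 : 0 ≤ α) (hα1 : α ≤ 1) (hr0 : 0 ≤ r) (hr1 : r ≤ 1) :
    (1 - r) * (1 + r) ^ (α + 1 / 2) ≤ 1 + r * (α - 1 / 2) := by
  rcases le_total α (1 / 2) with h | h
  · have := rpow_one_add_le_one_add_mul_self (s := r) (by linarith) (p := α + 1 / 2)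
      (by linarith) (by linarith)
    calc _ ≤ (1 - r) * (1 + (α + 1 / 2) * r) := by gcongr
      _ ≤ _ := by nlinarith [mul_nonneg (by linarith : 0 ≤ α + 1 / 2) (sq_nonneg r)]
  · have := rpow_one_add_le_one_add_mul_self (s := r) (by linarith) (p := α - 1 / 2)
      (by linarith) (by linarith)
    have e : (1 + r) ^ (α + 1 / 2) = (1 + r) ^ (α - 1 / 2) * (1 + r) := by
      rw [← Real.rpow_add_one (by linarith)]; ring_nf
    rw [e]
    calc _ ≤ (1 - r) * ((1 + (α - 1 / 2) * r) * (1 + r)) := by gcongr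
      _ ≤ _ := by
        have : 0 ≤ r ^ 2 * (1 + (α - 1 / 2) * r) :=
          mul_nonneg (sq_nonneg r) (by nlinarith [mul_nonneg (by linarith : 0 ≤ α - 1 / 2) hr0])
        nlinarith

/-- The exponent `α - 3/2` is the one whose square, times `1 + r`, gives the power in
`distortionA_le`. The difference of the two sides has derivative of the sign given by
`one_sub_mul_rpow_le`. -/
theorem distortionL_le {α r : ℝ} (hα0 : 0 ≤ α) (hα1 : α ≤ 1) (hr0 : 0 ≤ r) (hr1 : r ≤ 1) :
    distortionL r α ≤ r * (1 + r) ^ (α - 3 / 2) := by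
  have hd : ∀ s ∈ Icc (0 : ℝ) 1,
      HasDerivAt (fun r => r * (1 + r) ^ (α - 3 / 2) - distortionL r α)
        ((1 + s) ^ (α - 5 / 2) * (1 + s * (α - 1 / 2) - (1 - s) * (1 + s) ^ (α + 1 / 2))) s :=
    fun s hs => by
      have h1 : 0 < 1 + s := by linarith [hs.1]
      have hp : HasDerivAt (fun r : ℝ => (1 + r) ^ (α - 3 / 2))
          (1 * (α - 3 / 2) * (1 + s) ^ (α - 3 / 2 - 1)) s :=
        ((hasDerivAt_id s).const_add 1).rpow_const (Or.inl h1.ne')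
      refine (((hasDerivAt_id s).mul hp).sub
        (hasDerivAt_distortionL α (by linarith))).congr_deriv ?_
      have e1 : (1 + s) ^ (2 * α - 2) = (1 + s) ^ (α - 5 / 2) * (1 + s) ^ (α + 1 / 2) := by
        rw [← Real.rpow_add h1]; ring_nf
      have e2 : (1 + s) ^ (α - 3 / 2) = (1 + s) ^ (α - 5 / 2) * (1 + s) := by
        rw [← Real.rpow_add_one h1.ne']; ring_nf
      have e3 : α - 3 / 2 - 1 = α - 5 / 2 := by ring
      rw [e1, e2, e3]
      simp only [id]
      ring
  have hm : MonotoneOn (fun r => r * (1 + r) ^ (α - 3 / 2) - distortionL r α) (Icc 0 1) := by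
    refine monotoneOn_of_deriv_nonneg (convex_Icc _ _)
      (fun s hs => (hd s hs).continuousAt.continuousWithinAt)
      (fun s hs => (hd s (interior_subset hs)).differentiableAt.differentiableWithinAt) ?_
    intro s hs
    have hs := interior_subset hs
    rw [(hd s hs).deriv]
    exact mul_nonneg (Real.rpow_nonneg (by linarith [hs.1]) _)
      (sub_nonneg.2 (one_sub_mul_rpow_le hα0 hα1 hs.1 hs.2))
  simpa [distortionL_zero] using hm (left_mem_Icc.2 zero_le_one) ⟨hr0, hr1⟩ hr0

theorem distortionA_le {α r : ℝ} (hα0 : 0 ≤ α) (hα1 : α ≤ 1) (hr0 : 0 < r) (hr1 : r ≤ 1) :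
    distortionA r α ≤ (1 - r) * (1 + r) ^ (2 * α - 2) := by
  have h1 : 0 < 1 + r := by linarith
  have hL := pow_le_pow_left₀ (distortionL_nonneg hr0.le hr1)
    (distortionL_le hα0 hα1 hr0.le hr1) 2
  have e : (r * (1 + r) ^ (α - 3 / 2)) ^ 2 * (1 + r) = r ^ 2 * (1 + r) ^ (2 * α - 2) := by
    rw [mul_pow, ← Real.rpow_natCast ((1 + r) ^ (α - 3 / 2)), ← Real.rpow_mul h1.le, mul_assoc,
      ← Real.rpow_add_one h1.ne']
    push_cast
    ring_nf
  unfold distortionA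
  rw [div_mul_eq_mul_div, div_le_iff₀ (by positivity)]
  calc (1 - r ^ 2) * distortionL r α ^ 2
      ≤ (1 - r ^ 2) * (r * (1 + r) ^ (α - 3 / 2)) ^ 2 := by
        gcongr
        nlinarith
    _ = (1 - r) * ((r * (1 + r) ^ (α - 3 / 2)) ^ 2 * (1 + r)) := by ring
    _ = (1 - r) * (1 + r) ^ (2 * α - 2) * r ^ 2 := by rw [e]; ring

/-! ### The two distortion bounds -/

theorem theorem1 (α : ℝ) (hα0 : 0 ≤ α) (hα1 : α < 1) (f h g : ℂ → ℂ)
    (hf : MemClassF α f h g) (lam : ℂ) (hlam : ‖lam‖ = 1) (F : ℂ → ℂ)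
    (hF : ∀ z, F z = h z + lam * g z)
    (t ψ : ℝ) (htψ : Complex.exp (t * Complex.I) ≠ Complex.exp (ψ * Complex.I))
    (r : ℝ) (hr0 : 0 < r) (hr1 : r < 1) :
    distortionA r α ≤
        ‖(F (polarPoint r t) - F (polarPoint r ψ)) / (polarPoint r t - polarPoint r ψ)‖ ∧
      distortionA r α ≤
        ‖(f (polarPoint r t) - f (polarPoint r ψ)) / (polarPoint r t - polarPoint r ψ)‖ := by
  obtain ⟨θ, hθ⟩ := hf.dilatation
  obtain ⟨q, hq0, hq⟩ := exists_exp_eq_deriv hf.analytic_h hf.deriv_ne_zero hf.deriv_h_zero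
  set q' : ℂ → ℂ := fun z => deriv (deriv h) z / deriv h z
  have hqd : ∀ z ∈ ball (0 : ℂ) 1, HasDerivAt q (q' z) z := fun z hz => (hq z hz).1
  have hh : ∀ z ∈ ball (0 : ℂ) 1, HasDerivAt h (exp (q z)) z := fun z hz => by
    rw [← (hq z hz).2]
    exact (hf.analytic_h.differentiableAt (isOpen_ball.mem_nhds hz)).hasDerivAt
  have hg : ∀ z ∈ ball (0 : ℂ) 1, HasDerivAt g (exp (θ * I) * z * exp (q z)) z := fun z hz => by
    rw [← (hq z hz).2, ← hθ z hz]
    exact (hf.analytic_g.differentiableAt (isOpen_ball.mem_nhds hz)).hasDerivAt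
  have hord : ∀ z ∈ ball (0 : ℂ) 1, α < (1 + z * q' z).re := fun z hz => by
    have := hf.convex_order z hz
    rwa [mul_div_assoc] at this
  have hconv : ∀ z ∈ ball (0 : ℂ) 1, 0 < (1 + z * q' z).re := fun z hz =>
    hα0.trans_lt (hord z hz)
  have hsub : closedBall (0 : ℂ) r ⊆ ball 0 1 := closedBall_subset_ball hr1
  have hmem : ∀ s, polarPoint r s ∈ closedBall (0 : ℂ) r := fun s => by
    rw [mem_closedBall_zero_iff, polarPoint, norm_ofReal_mul_exp hr0.le]
  have hab : polarPoint r t - polarPoint r ψ ≠ 0 := by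
    unfold polarPoint
    rw [← mul_sub]
    exact mul_ne_zero (ofReal_ne_zero.2 hr0.ne') (sub_ne_zero.2 htψ)
  have ha := hmem t
  have hb := hmem ψ
  generalize polarPoint r t = a at ha hab ⊢
  generalize polarPoint r ψ = b at hb hab ⊢
  have h1r : 0 < 1 + r := by linarith
  have h1 : ‖a - b‖ ≤ (1 + r) ^ (2 - 2 * α) * ‖h a - h b‖ := by
    refine norm_sub_le_mul_norm_sub_of_deriv hh hqd hconv (G := fun z => z) (G' := fun _ => 1)
      hr0 hr1 (fun z _ => hasDerivAt_id z) (fun z hz => ?_) hb ha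
    have hz' : ‖z‖ ≤ r := mem_closedBall_zero_iff.1 hz
    have := re_log_deriv_ge hα1 hq0 hqd hord (hz'.trans_lt hr1)
    rw [one_mul, ← exp_neg, norm_exp, neg_re, Real.rpow_def_of_pos h1r, Real.exp_le_exp]
    have hl : Real.log (1 + ‖z‖) ≤ Real.log (1 + r) :=
      Real.log_le_log (by positivity) (by linarith)
    nlinarith
  have h2 : ‖g a - g b‖ ≤ r * ‖h a - h b‖ := by
    refine norm_sub_le_mul_norm_sub_of_deriv hh hqd hconv hr0 hr1
      (fun z hz => hg z (hsub hz)) (fun z hz => ?_) hb ha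
    rw [mul_inv_cancel_right₀ (exp_ne_zero _), norm_mul, norm_exp_ofReal_mul_I, one_mul]
    exact mem_closedBall_zero_iff.1 hz
  -- Only the modulus of the perturbation matters, so `d` serves for both `λ Δg` and `conj Δg`.
  have key : ∀ d : ℂ, ‖d‖ = ‖g a - g b‖ →
      distortionA r α ≤ ‖(h a - h b + d) / (a - b)‖ := fun d hd => by
    refine (distortionA_le hα0 hα1.le hr0 hr1.le).trans ?_
    rw [norm_div, le_div_iff₀ (norm_pos_iff.2 hab)]
    have h3 : ‖h a - h b‖ - ‖d‖ ≤ ‖h a - h b + d‖ := norm_sub_le_norm_add _ _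
    have hpow : (1 + r) ^ (2 * α - 2) * (1 + r) ^ (2 - 2 * α) = 1 := by
      rw [← Real.rpow_add h1r]; ring_nf; simp
    calc (1 - r) * (1 + r) ^ (2 * α - 2) * ‖a - b‖
        ≤ (1 - r) * (1 + r) ^ (2 * α - 2) * ((1 + r) ^ (2 - 2 * α) * ‖h a - h b‖) := by
          have : 0 ≤ 1 - r := by linarith
          gcongr
      _ = (1 - r) * ((1 + r) ^ (2 * α - 2) * (1 + r) ^ (2 - 2 * α)) * ‖h a - h b‖ := by ring
      _ ≤ ‖h a - h b + d‖ := by rw [hpow]; linarith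
  constructor
  · have e : F a - F b = h a - h b + lam * (g a - g b) := by rw [hF, hF]; ring
    rw [e]
    exact key _ (by rw [norm_mul, hlam, one_mul])
  · have e : f a - f b = h a - h b + conj (g a - g b) := by
      rw [hf.eq_add_conj a (hsub ha), hf.eq_add_conj b (hsub hb), map_sub]; ring
    rw [e]
    exact key _ (norm_conj _)
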